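/- Let $U\subset\mathbb R^2$ be an open neighbourhood of $0$ and let $\mathbf x:U\to\mathbb R^3$ be a $C^\infty$ map with $\mathbf x(0)=0$. Suppose that $\mathbf x$ is a proper wavefront: every point of $U$ has an open neighbourhood $V\subset U$ with a smooth unit vector field $\mathbf n:V\to\mathbb R^3$ along $\mathbf x$, orthogonal to $\mathbf x_u$ and $\mathbf x_v$, such that $(\mathbf x,\mathbf n)$ is an immersion on $V$; and the set $\Sigma(\mathbf x)$ of points at which $\mathbf x$ is not immersive has empty interior. Suppose that $\operatorname{rank} D\mathbf x(0)=1$ and that $\mathbf x$ is parallelly smoothable at $0\in\Sigma(\mathbf x)$: there are $\epsilon>0$, an open neighbourhood $V\subset U$ of $0$ and a smooth unit normal field $\mathbf n$ along $\mathbf x$ on $V$ such that $\operatorname{rank} D(\mathbf x+l\mathbf n)(q)=2$ for all $(q,l)\in V\times(0,\epsilon)$, or for all $(q,l)\in V\times(-\epsilon,0)$. Then there are $r>0$, smooth functions $\lambda:(-r,r)^2\to\mathbb R$ and $f_1,f_2:(-r,r)\to\mathbb R$ with $\lambda(0,0)=0$, a linear isometry $\phi$ of $\mathbb R^3$, and a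 diffeomorphism $\mathbf h$ from an open neighbourhood of $0$ in $(-r,r)^2$ onto an open neighbourhood of $0$ in $U$ with $\mathbf h(0)=0$, such that $\phi\circ\mathbf x\circ\mathbf h=\mathbf y$ on the domain of $\mathbf h$, where $$\mathbf y(w,z)=\Big(w,\ \int_0^z\lambda(w,t)\,dt+f_1(w),\ \int_0^z t\,\lambda(w,t)\,dt+f_2(w)\Big),$$ and such that $\lambda$ does not change sign: either $\lambda\ge 0$ on $(-r,r)^2$ or $\lambda\le 0$ on $(-r,r)^2$. Moreover, on $(-r,r)^2$ the smooth $3\times 2$ matrix-valued map $\hat\Omega$ with columns $\mathbf y_w$ and $(0,1,z)^T$ is a tangent moving basis of $\mathbf y$ (its columns are linearly independent and their span contains $\mathbf y_w,\mathbf y_z$), and $$\Lambda_{\hat\Omega}:=D\mathbf y^T\,\hat\Omega\,(\hat\Omega^T\hat\Omega)^{-1}=\begin{pmatrix}1&0\\0&\lambda\end{pmatrix}.$$ -/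

import Mathlib

open Set Topology
open scoped ContDiff

namespace Wavefront

/-- Euclidean three-space. -/
abbrev E3 := EuclideanSpace ℝ (Fin 3)

/-- `rank(Df(q))`, the rank of the differential of `f` at `q`. -/
noncomputable def rankD (f : ℝ × ℝ → E3) (q : ℝ × ℝ) : ℕ :=
  Module.finrank ℝ (LinearMap.range (fderiv ℝ f q : ℝ × ℝ →ₗ[ℝ] E3))

/-- The Jacobian matrix `Df(q)`, whose columns are the two partial derivatives. -/
noncomputable def jacobian (f : ℝ × ℝ → E3) (q : ℝ × ℝ) : Matrix (Fin 3) (Fin 2) ℝ :=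
  Matrix.of fun i j => (fderiv ℝ f q (![(1, 0), (0, 1)] j)) i

/-- The set of points of `U` at which `x` is not immersive. -/
def singularSet (x : ℝ × ℝ → E3) (U : Set (ℝ × ℝ)) : Set (ℝ × ℝ) :=
  {p ∈ U | ¬ Function.Injective (fderiv ℝ x p)}

/-- `n` is a smooth unit normal vector field along `x` on `V`. -/
def IsUnitNormalOn (x n : ℝ × ℝ → E3) (V : Set (ℝ × ℝ)) : Prop :=
  ContDiffOn ℝ ∞ n V ∧ ∀ q ∈ V, ‖n q‖ = 1 ∧ ∀ v : ℝ × ℝ, inner ℝ (fderiv ℝ x q v) (n q) = 0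

/-- `x : U → ℝ³` is a wavefront: it is smooth on the open set `U`, and around each point of `U`
there is a smooth unit normal field `n` along `x` such that `(x, n)` is an immersion. -/
def IsWavefrontOn (x : ℝ × ℝ → E3) (U : Set (ℝ × ℝ)) : Prop :=
  IsOpen U ∧ ContDiffOn ℝ ∞ x U ∧
    ∀ p ∈ U, ∃ (V : Set (ℝ × ℝ)) (n : ℝ × ℝ → E3), IsOpen V ∧ p ∈ V ∧ V ⊆ U ∧
      IsUnitNormalOn x n V ∧
      ∀ q ∈ V, Function.Injective (fderiv ℝ (fun s => (x s, n s)) q)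

/-- `x : U → ℝ³` is proper: its singular set has empty interior. -/
def IsProperOn (x : ℝ × ℝ → E3) (U : Set (ℝ × ℝ)) : Prop :=
  interior (singularSet x U) = ∅

/-- `x : U → ℝ³` is parallelly smoothable at its singular point `p`: on a neighbourhood `V` of `p`
carrying a smooth unit normal field `n`, the parallel maps `x + l n` have rank `2` everywhere, for
all small `l > 0` or for all small `l < 0`. -/
def IsParallellySmoothableAt (x : ℝ × ℝ → E3) (U : Set (ℝ × ℝ)) (p : ℝ × ℝ) : Prop :=
  p ∈ singularSet x U ∧
    ∃ (V : Set (ℝ × ℝ)) (n : ℝ × ℝ → E3) (ε : ℝ), IsOpen V ∧ p ∈ V ∧ V ⊆ U ∧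
      IsUnitNormalOn x n V ∧ 0 < ε ∧
      ((∀ q ∈ V, ∀ l ∈ Ioo 0 ε, rankD (fun s => x s + l • n s) q = 2) ∨
        (∀ q ∈ V, ∀ l ∈ Ioo (-ε) 0, rankD (fun s => x s + l • n s) q = 2))

/-- `Ω` is a tangent moving basis of `x` on `U`: a smooth matrix-valued map whose two columns are
linearly independent and span a plane containing the partial derivatives of `x`. -/
def IsTangentMovingBasis (x : ℝ × ℝ → E3) (Ω : ℝ × ℝ → Matrix (Fin 3) (Fin 2) ℝ)
    (U : Set (ℝ × ℝ)) : Prop :=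
  (∀ i j, ContDiffOn ℝ ∞ (fun q => Ω q i j) U) ∧
    ∀ q ∈ U, LinearIndependent ℝ (Ω q).col ∧
      ∀ j, (jacobian x q).col j ∈ Submodule.span ℝ (range (Ω q).col)

/-- `Λ_Ω = Dxᵀ Ω (Ωᵀ Ω)⁻¹`. -/
noncomputable def LambdaMat (x : ℝ × ℝ → E3) (Ω : ℝ × ℝ → Matrix (Fin 3) (Fin 2) ℝ)
    (q : ℝ × ℝ) : Matrix (Fin 2) (Fin 2) ℝ :=
  (jacobian x q).transpose * Ω q * ((Ω q).transpose * Ω q)⁻¹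

/-- The germs at `0` of `f₁ : U₁ → ℝ³` and `f₂ : U₂ → ℝ³` are `ℛ`-equivalent: `f₂ = f₁ ∘ h` near
`0` for a diffeomorphism `h` from a neighbourhood of `0` in `U₂` onto a neighbourhood of `0` in
`U₁`, with `h 0 = 0`. -/
def REquivalent (f₁ : ℝ × ℝ → E3) (U₁ : Set (ℝ × ℝ)) (f₂ : ℝ × ℝ → E3) (U₂ : Set (ℝ × ℝ)) : Prop :=
  ∃ h : OpenPartialHomeomorph (ℝ × ℝ) (ℝ × ℝ),
    0 ∈ h.source ∧ h 0 = 0 ∧ h.source ⊆ U₂ ∧ h.target ⊆ U₁ ∧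
    ContDiffOn ℝ ∞ h h.source ∧ ContDiffOn ℝ ∞ h.symm h.target ∧
    ∀ q ∈ h.source, f₂ q = f₁ (h q)

/-- The map
`(w, z) ↦ (w, ∫₀ᶻ lam(w,t) dt + f₁(w), ∫₀ᶻ t lam(w,t) dt + f₂(w))`. -/
noncomputable def rankOneForm (lam : ℝ × ℝ → ℝ) (f₁ f₂ : ℝ → ℝ) (q : ℝ × ℝ) : E3 :=
  !₂[q.1, (∫ t in (0 : ℝ)..q.2, lam (q.1, t)) + f₁ q.1,
    (∫ t in (0 : ℝ)..q.2, t * lam (q.1, t)) + f₂ q.1]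

/-- The matrix-valued map with columns `y_w` and `(0, 1, z)`. -/
noncomputable def rankOneBasis (y : ℝ × ℝ → E3) (q : ℝ × ℝ) : Matrix (Fin 3) (Fin 2) ℝ :=
  Matrix.of fun i j => ![(fderiv ℝ y q (1, 0)) i, ![0, 1, q.2] i] j

end Wavefront

namespace Wavefront

/-! Rotate so that the image of the differential at the origin is the first axis and the unit normal
there is the third. Take as coordinates `w`, the first component of the rotated map, and `z =
-N₁/N₂`, the slope of the tangent plane along the second axis (components are numbered from 0). The
front condition makes this `slopeChart` a local diffeomorphism: symmetry of the second fundamental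
form and the unit length of `N` force any kernel vector to be killed by the differentials of both
the map and its normal.

In these coordinates, orthogonality to `N` says that the `z`-derivative is `λ (0, 1, z)`, and
integrating from `z = 0` gives the normal form.

For the sign, `λ` times the Jacobian determinant of the chart is the minor of the first two
components of the differential (`planeMinor`). The same minor of the parallel maps is nonzero for
small `l > 0`, hence of constant sign on a connected set, and `l → 0` leaves a weak sign. Properness
ensures that the normal used for the parallel maps is `±N` at the origin, so it too is transverse to
the horizontal plane. -/

theorem isOpen_square (r : ℝ) : IsOpen (Ioo (-r) r ×ˢ Ioo (-r) r) := isOpen_Ioo.prod isOpen_Ioo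

theorem hasDerivAt_vertical {Y : ℝ × ℝ → E3} {w t : ℝ} (h : DifferentiableAt ℝ Y (w, t))
    (i : Fin 3) : HasDerivAt (fun s => Y (w, s) i) ((fderiv ℝ Y (w, t) (0, 1)) i) t := by
  have h1 : HasDerivAt (fun s : ℝ => (w, s)) ((0 : ℝ), (1 : ℝ)) t :=
    (hasDerivAt_const t w).prodMk (hasDerivAt_id t)
  have h2 : HasDerivAt (fun s => Y (w, s)) (fderiv ℝ Y (w, t) (0, 1)) t :=
    HasFDerivAt.comp_hasDerivAt (f := fun s : ℝ => (w, s)) t h.hasFDerivAt h1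
  exact hasDerivAt_pi.1 ((PiLp.hasStrictFDerivAt_ofLp 2 (Y (w, t))).hasFDerivAt.comp_hasDerivAt t h2) i

theorem hasFDerivAt_coord {Y : ℝ × ℝ → E3} {q : ℝ × ℝ} (h : DifferentiableAt ℝ Y q) (i : Fin 3) :
    HasFDerivAt (fun p => Y p i) ((EuclideanSpace.proj i : E3 →L[ℝ] ℝ).comp (fderiv ℝ Y q)) q :=
  (EuclideanSpace.proj i : E3 →L[ℝ] ℝ).hasFDerivAt.comp q h.hasFDerivAt

theorem fderiv_apply_zero_of_eventuallyEq_fst {Y : ℝ × ℝ → E3} {q : ℝ × ℝ}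
    (h : DifferentiableAt ℝ Y q) (h1 : ∀ᶠ p in 𝓝 q, Y p 0 = p.1) (v : ℝ × ℝ) :
    (fderiv ℝ Y q v) 0 = v.1 :=
  congrArg (fun f : ℝ × ℝ →L[ℝ] ℝ => f v)
    (((hasFDerivAt_coord h 0).congr_of_eventuallyEq (f₁ := Prod.fst)
      (h1.mono fun _ hp => hp.symm)).unique hasFDerivAt_fst)

/-! ### The integral normal form and its tangent moving basis -/

section NormalForm

variable {Y : ℝ × ℝ → E3} {r : ℝ}

theorem contDiffOn_fderiv_apply {U : Set (ℝ × ℝ)} (hU : IsOpen U) (hY : ContDiffOn ℝ ∞ Y U)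
    (v : ℝ × ℝ) (i : Fin 3) : ContDiffOn ℝ ∞ (fun q => (fderiv ℝ Y q v) i) U := by
  have h := (hY.fderiv_of_isOpen hU (m := ∞) (by simp)).clm_apply (contDiffOn_const (c := v))
  exact (contDiffOn_euclidean.1 h) i

/-- Fundamental theorem of calculus on the vertical segment from `(w, 0)` to `(w, z)`; `h2` turns
the integrand of the third component into `t * lam`. -/
theorem rankOneForm_eqOn (hr : 0 < r) (hY : ContDiffOn ℝ ∞ Y (Ioo (-r) r ×ˢ Ioo (-r) r))
    (h1 : ∀ q ∈ Ioo (-r) r ×ˢ Ioo (-r) r, Y q 0 = q.1)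
    (h2 : ∀ q ∈ Ioo (-r) r ×ˢ Ioo (-r) r,
      (fderiv ℝ Y q (0, 1)) 2 = q.2 * (fderiv ℝ Y q (0, 1)) 1) :
    EqOn (rankOneForm (fun q => (fderiv ℝ Y q (0, 1)) 1) (fun w => Y (w, 0) 1)
      (fun w => Y (w, 0) 2)) Y (Ioo (-r) r ×ˢ Ioo (-r) r) := by
  rintro ⟨w, z⟩ ⟨hw, hz⟩
  have hseg : ∀ t ∈ uIcc 0 z, (w, t) ∈ Ioo (-r) r ×ˢ Ioo (-r) r := fun t ht =>
    ⟨hw, ordConnected_Ioo.uIcc_subset (by simp [hr]) hz ht⟩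
  have hd : ∀ i, ∀ t ∈ uIcc 0 z,
      HasDerivAt (fun s => Y (w, s) i) ((fderiv ℝ Y (w, t) (0, 1)) i) t := fun i t ht =>
    hasDerivAt_vertical
      ((hY.contDiffAt ((isOpen_square r).mem_nhds (hseg t ht))).differentiableAt (by simp)) i
  have hi : ∀ i, IntervalIntegrable (fun t => (fderiv ℝ Y (w, t) (0, 1)) i)
      MeasureTheory.volume 0 z := fun i =>
    ContinuousOn.intervalIntegrable <|
      (contDiffOn_fderiv_apply (isOpen_square r) hY (0, 1) i).continuousOn.comp
        (by fun_prop) hseg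
  have e1 := intervalIntegral.integral_eq_sub_of_hasDerivAt (hd 1) (hi 1)
  have e2 := intervalIntegral.integral_eq_sub_of_hasDerivAt (hd 2) (hi 2)
  have e3 : ∫ t in (0 : ℝ)..z, t * (fderiv ℝ Y (w, t) (0, 1)) 1 =
      ∫ t in (0 : ℝ)..z, (fderiv ℝ Y (w, t) (0, 1)) 2 :=
    intervalIntegral.integral_congr fun t ht => (h2 _ (hseg t ht)).symm
  ext i
  fin_cases i
  · simpa [rankOneForm] using (h1 (w, z) ⟨hw, hz⟩).symm
  · simp [rankOneForm, e1]
  · simp [rankOneForm, e3, e2]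

theorem jacobian_eq_rankOneBasis_mul {q : ℝ × ℝ} {c : ℝ}
    (h : ∀ i, (fderiv ℝ Y q (0, 1)) i = c * ![0, 1, q.2] i) :
    jacobian Y q = rankOneBasis Y q * !![1, 0; 0, c] := by
  ext i j
  fin_cases j
  · simp [jacobian, rankOneBasis, Matrix.mul_apply, Fin.sum_univ_two]
  · simp [jacobian, rankOneBasis, Matrix.mul_apply, Fin.sum_univ_two, h, mul_comm]

theorem rankOneBasis_mulVec_injective {q : ℝ × ℝ} (h : (fderiv ℝ Y q (1, 0)) 0 = 1) :
    Function.Injective (rankOneBasis Y q).mulVec := by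
  rw [← Matrix.coe_mulVecLin, ← LinearMap.ker_eq_bot, LinearMap.ker_eq_bot']
  intro v hv
  have a0 := congrFun hv 0
  have a1 := congrFun hv 1
  simp [rankOneBasis, Matrix.mulVec, dotProduct, Fin.sum_univ_two, h] at a0 a1
  ext i
  fin_cases i
  · simpa using a0
  · simpa [a0] using a1

/-- Injectivity makes the Gram matrix `Ωᵀ Ω` positive definite, so it cancels against its inverse in
`Aᵀ Ωᵀ Ω (Ωᵀ Ω)⁻¹`. -/
theorem lambdaMat_eq_of_jacobian_eq {Ω : ℝ × ℝ → Matrix (Fin 3) (Fin 2) ℝ} {q : ℝ × ℝ}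
    {A : Matrix (Fin 2) (Fin 2) ℝ} (hΩ : Function.Injective (Ω q).mulVec)
    (h : jacobian Y q = Ω q * A) : LambdaMat Y Ω q = A.transpose := by
  have hdet : IsUnit ((Ω q).transpose * Ω q).det := by
    have := (Matrix.PosDef.conjTranspose_mul_self (Ω q) hΩ).det_pos.ne'
    rw [Matrix.conjTranspose_eq_transpose_of_trivial] at this
    exact this.isUnit
  rw [LambdaMat, h, Matrix.transpose_mul, Matrix.mul_assoc A.transpose, Matrix.mul_assoc,
    Matrix.mul_nonsing_inv _ hdet, Matrix.mul_one]

/-- Smoothness is known for `Y`, not directly for the integral formula `y`. Agreement on an open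
square suffices, since it transfers derivatives. -/
theorem rankOneForm_spec (hY : ContDiffOn ℝ ∞ Y (Ioo (-r) r ×ˢ Ioo (-r) r))
    (h1 : ∀ q ∈ Ioo (-r) r ×ˢ Ioo (-r) r, Y q 0 = q.1)
    (h2 : ∀ q ∈ Ioo (-r) r ×ˢ Ioo (-r) r,
      (fderiv ℝ Y q (0, 1)) 2 = q.2 * (fderiv ℝ Y q (0, 1)) 1)
    {lam : ℝ × ℝ → ℝ} (hlam : ∀ q, lam q = (fderiv ℝ Y q (0, 1)) 1) {y : ℝ × ℝ → E3}
    (hy : EqOn y Y (Ioo (-r) r ×ˢ Ioo (-r) r)) :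
    IsTangentMovingBasis y (rankOneBasis y) (Ioo (-r) r ×ˢ Ioo (-r) r) ∧
      ∀ q ∈ Ioo (-r) r ×ˢ Ioo (-r) r, LambdaMat y (rankOneBasis y) q = !![1, 0; 0, lam q] := by
  have hS := isOpen_square r
  have hD : ∀ q ∈ Ioo (-r) r ×ˢ Ioo (-r) r, fderiv ℝ y q = fderiv ℝ Y q := fun q hq =>
    (hy.eventuallyEq_of_mem (hS.mem_nhds hq)).fderiv_eq
  have hD0 : ∀ q ∈ Ioo (-r) r ×ˢ Ioo (-r) r, ∀ v, (fderiv ℝ Y q v) 0 = v.1 := fun q hq v =>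
    fderiv_apply_zero_of_eventuallyEq_fst
      ((hY.contDiffAt (hS.mem_nhds hq)).differentiableAt (by simp))
      (Filter.eventually_of_mem (hS.mem_nhds hq) h1) v
  have hinj : ∀ q ∈ Ioo (-r) r ×ˢ Ioo (-r) r,
      Function.Injective (rankOneBasis y q).mulVec := fun q hq =>
    rankOneBasis_mulVec_injective (by rw [hD q hq, hD0 q hq])
  have hjac : ∀ q ∈ Ioo (-r) r ×ˢ Ioo (-r) r,
      jacobian y q = rankOneBasis y q * !![1, 0; 0, lam q] := fun q hq => by
    refine jacobian_eq_rankOneBasis_mul fun i => ?_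
    rw [hD q hq]
    fin_cases i
    · simpa using hD0 q hq (0, 1)
    · simp [hlam]
    · simp [hlam, h2 q hq, mul_comm]
  refine ⟨⟨?_, fun q hq => ⟨?_, fun j => ?_⟩⟩, fun q hq => ?_⟩
  · intro i j
    fin_cases j
    · refine (contDiffOn_fderiv_apply hS hY (1, 0) i).congr fun q hq => ?_
      simp [rankOneBasis, hD q hq]
    · fin_cases i
      · simpa [rankOneBasis] using contDiffOn_const
      · simpa [rankOneBasis] using contDiffOn_const
      · simpa [rankOneBasis] using contDiff_snd.contDiffOn
  · exact Matrix.mulVec_injective_iff.1 (hinj q hq)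
  · rw [hjac q hq, ← Matrix.range_mulVecLin]
    exact ⟨(!![1, 0; 0, lam q] : Matrix (Fin 2) (Fin 2) ℝ).col j, rfl⟩
  · rw [lambdaMat_eq_of_jacobian_eq (hinj q hq) (hjac q hq)]
    ext i j
    fin_cases i <;> fin_cases j <;> simp

end NormalForm

/-! ### Inverting a chart over a square -/

theorem exists_localInverse_on_square {Φ : ℝ × ℝ → ℝ × ℝ} {O : Set (ℝ × ℝ)} (hO : IsOpen O)
    (h0 : 0 ∈ O) (hΦ : ContDiffOn ℝ ∞ Φ O) (hΦ0 : Φ 0 = 0)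
    (hinj : ∀ q ∈ O, Function.Injective (fderiv ℝ Φ q)) :
    ∃ (r : ℝ) (h : OpenPartialHomeomorph (ℝ × ℝ) (ℝ × ℝ)), 0 < r ∧
      h.source = Ioo (-r) r ×ˢ Ioo (-r) r ∧ h 0 = 0 ∧ h.target ⊆ O ∧
      ContDiffOn ℝ ∞ h h.source ∧ ContDiffOn ℝ ∞ h.symm h.target ∧
      (∀ p ∈ h.target, h.symm p = Φ p) := by
  have hequiv : ∀ q ∈ O, ∃ e : (ℝ × ℝ) ≃L[ℝ] (ℝ × ℝ), HasFDerivAt Φ (e : _ →L[ℝ] _) q := by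
    intro q hq
    refine ⟨(LinearEquiv.ofInjectiveEndo (fderiv ℝ Φ q : ℝ × ℝ →ₗ[ℝ] ℝ × ℝ)
      (hinj q hq)).toContinuousLinearEquiv, ?_⟩
    exact ((hΦ.contDiffAt (hO.mem_nhds hq)).differentiableAt (by simp)).hasFDerivAt
  obtain ⟨e, he⟩ := hequiv 0 h0
  have hc := hΦ.contDiffAt (hO.mem_nhds h0)
  let f := (hc.toOpenPartialHomeomorph Φ he (by simp)).restrOpen O hO
  have hfs : f.source ⊆ O := inter_subset_right
  have hf : ∀ p, f p = Φ p := fun p => rfl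
  have hf0 : (0 : ℝ × ℝ) ∈ f.source :=
    ⟨hc.mem_toOpenPartialHomeomorph_source he (by simp), h0⟩
  have ht : f.target ∈ 𝓝 ((0 : ℝ), (0 : ℝ)) := by
    refine f.open_target.mem_nhds ?_
    have := f.map_source hf0
    rwa [hf, hΦ0] at this
  obtain ⟨r, hr, hball⟩ := Metric.mem_nhds_iff.1 ht
  have hsq : Ioo (-r) r ×ˢ Ioo (-r) r ⊆ f.target := by
    rw [← ball_prod_same, Real.ball_eq_Ioo, zero_sub, zero_add] at hball
    exact hball
  have hS := isOpen_square r
  -- Smoothness of the inverse is obtained point by point, which uses invertibility of the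
  -- differential on all of `O`, not only at the origin.
  have hsmooth : ∀ q ∈ f.target, ContDiffAt ℝ ∞ f.symm q := fun q hq => by
    have hm := hfs (f.map_target hq)
    obtain ⟨e', he'⟩ := hequiv _ hm
    exact f.contDiffAt_symm hq he' (hΦ.contDiffAt (hO.mem_nhds hm))
  refine ⟨r, f.symm.restrOpen _ hS, hr, ?_, ?_, ?_, ?_, ?_, ?_⟩
  · exact inter_eq_right.2 hsq
  · have := f.left_inv hf0
    rwa [hf, hΦ0] at this
  · exact fun p hp => hfs hp.1
  · exact fun q hq => (hsmooth q hq.1).contDiffWithinAt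
  · exact hΦ.mono fun p hp => hfs hp.1
  · exact fun p _ => rfl

/-! ### Adapting the frame and comparing unit normals -/

theorem exists_isometry_of_orthogonal {t n : E3} (ht : ‖t‖ = 1) (hn : ‖n‖ = 1)
    (htn : inner ℝ t n = 0) : ∃ φ : E3 ≃ₗᵢ[ℝ] E3,
      φ t = EuclideanSpace.single 0 1 ∧ φ n = EuclideanSpace.single 2 1 := by
  have hv : Orthonormal ℝ (({0, 2} : Set (Fin 3)).domRestrict ![t, 0, n]) := by
    rw [orthonormal_iff_ite]
    rintro ⟨i, hi⟩ ⟨j, hj⟩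
    have h20 : inner ℝ n t = 0 := by rw [real_inner_comm, htn]
    rcases hi with rfl | rfl <;> rcases hj with rfl | rfl
    · simp [ht, Set.domRestrict]
    · rw [if_neg fun h => absurd (congrArg Subtype.val h) (by decide)]
      exact htn
    · rw [if_neg fun h => absurd (congrArg Subtype.val h) (by decide)]
      exact h20
    · simp [hn, Set.domRestrict]
  obtain ⟨b, hb⟩ := hv.exists_orthonormalBasis_extension_of_card_eq (by simp)
  refine ⟨b.repr, ?_, ?_⟩
  · rw [← b.repr_self 0, hb 0 (by simp)]; rfl
  · rw [← b.repr_self 2, hb 2 (by simp)]; rfl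

/-- The orthogonal complement of the image plane is a line, so two unit normals differ by a sign;
squaring removes it. -/
theorem inner_sq_eq_one_of_orthogonal {A : ℝ × ℝ →L[ℝ] E3} (hA : Function.Injective A) {n m : E3}
    (hn : ‖n‖ = 1) (hm : ‖m‖ = 1) (hAn : ∀ v, inner ℝ (A v) n = 0)
    (hAm : ∀ v, inner ℝ (A v) m = 0) : inner ℝ n m ^ 2 = 1 := by
  let K := LinearMap.range (A : ℝ × ℝ →ₗ[ℝ] E3)
  have hK : Module.finrank ℝ K = 2 := by
    rw [LinearMap.finrank_range_of_inj hA]; simp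
  have hKo : Module.finrank ℝ Kᗮ = 1 := by
    have := K.finrank_add_finrank_orthogonal
    rw [hK, finrank_euclideanSpace, Fintype.card_fin] at this
    omega
  have hnK : n ∈ Kᗮ := by
    rw [Submodule.mem_orthogonal]; rintro _ ⟨v, rfl⟩; exact hAn v
  have hmK : m ∈ Kᗮ := by
    rw [Submodule.mem_orthogonal]; rintro _ ⟨v, rfl⟩; exact hAm v
  have hn0 : (⟨n, hnK⟩ : Kᗮ) ≠ 0 := fun h => by
    have : n = 0 := congrArg Subtype.val h
    simp [this] at hn
  obtain ⟨c, hc⟩ := (finrank_eq_one_iff_of_nonzero' _ hn0).1 hKo ⟨m, hmK⟩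
  have hc' : c • n = m := congrArg Subtype.val hc
  have h1 : |c| = 1 := by rw [← hc', norm_smul, hn, mul_one] at hm; exact hm
  rw [← hc', inner_smul_right, real_inner_self_eq_norm_sq, hn]
  simp [← sq_abs c, h1]

/-- The points where the squared inner product differs from 1 form an open set of singular points,
which properness makes empty. This reaches singular `p` as well. -/
theorem inner_unitNormal_sq_eq_one {x n m : ℝ × ℝ → E3} {U V W : Set (ℝ × ℝ)} {p : ℝ × ℝ}
    (hx : IsProperOn x U) (hV : IsOpen V) (hW : IsOpen W) (hVU : V ⊆ U) (hpV : p ∈ V)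
    (hpW : p ∈ W) (hn : IsUnitNormalOn x n V) (hm : IsUnitNormalOn x m W) :
    inner ℝ (n p) (m p) ^ 2 = 1 := by
  by_contra hne
  have hc : ContinuousOn (fun q => inner ℝ (n q) (m q) ^ 2) (V ∩ W) :=
    ((hn.1.continuousOn.mono inter_subset_left).inner
      (hm.1.continuousOn.mono inter_subset_right)).pow 2
  have ho := hc.isOpen_inter_preimage (hV.inter hW) (isOpen_compl_singleton (x := (1 : ℝ)))
  have hsub : (V ∩ W) ∩ (fun q => inner ℝ (n q) (m q) ^ 2) ⁻¹' {1}ᶜ ⊆ singularSet x U :=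
    fun q hq => ⟨hVU hq.1.1, fun hinj => hq.2 <|
      inner_sq_eq_one_of_orthogonal hinj (hn.2 q hq.1.1).1 (hm.2 q hq.1.2).1
        (hn.2 q hq.1.1).2 (hm.2 q hq.1.2).2⟩
  have := interior_maximal hsub ho ⟨⟨hpV, hpW⟩, hne⟩
  rw [hx] at this
  exact this

theorem two_le_infty : (2 : WithTop ℕ∞) ≤ ∞ := ENat.LEInfty.out

/-- Symmetry of the second fundamental form: differentiate `⟨Dx u, n⟩ = 0` along `v` and use the
symmetry of the second derivative of `x`. -/
theorem inner_fderiv_normal_symm {x n : ℝ × ℝ → E3} {V : Set (ℝ × ℝ)} (hV : IsOpen V)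
    (hx : ContDiffOn ℝ ∞ x V) (hn : IsUnitNormalOn x n V) {p : ℝ × ℝ} (hp : p ∈ V)
    (u v : ℝ × ℝ) :
    inner ℝ (fderiv ℝ x p u) (fderiv ℝ n p v) = inner ℝ (fderiv ℝ x p v) (fderiv ℝ n p u) := by
  have hxp := hx.contDiffAt (hV.mem_nhds hp)
  have hdn := ((hn.1.contDiffAt (hV.mem_nhds hp)).differentiableAt (by simp)).hasFDerivAt
  have hdx : HasFDerivAt (fderiv ℝ x) (fderiv ℝ (fderiv ℝ x) p) p :=
    ((hxp.fderiv_right (m := 1) (one_add_one_eq_two.trans_le two_le_infty)).differentiableAt (by simp)).hasFDerivAt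
  have key : ∀ u v, inner ℝ (fderiv ℝ x p u) (fderiv ℝ n p v) +
      inner ℝ (fderiv ℝ (fderiv ℝ x) p v u) (n p) = 0 := by
    intro u v
    have h1 := (hdx.clm_apply (hasFDerivAt_const u p)).inner ℝ hdn
    have h2 := h1.congr_of_eventuallyEq (f₁ := fun _ => (0 : ℝ)) (by
      filter_upwards [hV.mem_nhds hp] with q hq using ((hn.2 q hq).2 u).symm)
    have h3 := congrArg (fun f : ℝ × ℝ →L[ℝ] ℝ => f v) (h2.unique (hasFDerivAt_const _ _))
    simpa using h3
  have hs : IsSymmSndFDerivAt ℝ x p := hxp.isSymmSndFDerivAt (by simpa using two_le_infty)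
  have a := key u v
  have b := key v u
  rw [hs.eq u v] at b
  linarith

/-! ### Planar determinants and constancy of sign -/

/-- The Jacobian determinant of the first two components of a linear map into `ℝ³`. -/
def planeMinor (A : ℝ × ℝ →L[ℝ] E3) : ℝ :=
  (A (1, 0)) 0 * (A (0, 1)) 1 - (A (0, 1)) 0 * (A (1, 0)) 1

/-- The determinant of an endomorphism of the plane. -/
def planeDet (A : ℝ × ℝ →L[ℝ] ℝ × ℝ) : ℝ :=
  (A (1, 0)).1 * (A (0, 1)).2 - (A (0, 1)).1 * (A (1, 0)).2

theorem map_eq_smul_add_smul {F : Type*} [NormedAddCommGroup F] [NormedSpace ℝ F]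
    (A : ℝ × ℝ →L[ℝ] F) (v : ℝ × ℝ) : A v = v.1 • A (1, 0) + v.2 • A (0, 1) := by
  rw [← map_smul, ← map_smul, ← map_add]
  congr 1
  ext <;> simp

theorem injective_iff_planeDet_ne_zero {A : ℝ × ℝ →L[ℝ] ℝ × ℝ} :
    Function.Injective A ↔ planeDet A ≠ 0 := by
  constructor
  · intro hA h0
    rw [injective_iff_map_eq_zero] at hA
    -- Up to sign, this vector and the next are the columns of the adjugate, which `A` kills when
    -- its determinant vanishes.
    have h1 := hA ((A (0, 1)).1, -(A (1, 0)).1) (by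
      rw [map_eq_smul_add_smul]
      ext
      · simp; ring
      · simp only [planeDet] at h0
        simp; linarith)
    have h2 := hA ((A (0, 1)).2, -(A (1, 0)).2) (by
      rw [map_eq_smul_add_smul]
      ext
      · simp only [planeDet] at h0
        simp; linarith
      · simp; ring)
    simp only [Prod.mk_eq_zero] at h1 h2
    have := hA (0, 1) (Prod.ext h1.1 h2.1)
    simp at this
  · intro h
    rw [injective_iff_map_eq_zero]
    intro v hv
    rw [map_eq_smul_add_smul] at hv
    have h1 := congrArg Prod.fst hv
    have h2 := congrArg Prod.snd hv
    simp at h1 h2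
    refine Prod.ext ?_ ?_
    · refine (mul_eq_zero.1 ?_).resolve_right h
      simp only [planeDet]
      linear_combination (A (0, 1)).2 * h1 - (A (0, 1)).1 * h2
    · refine (mul_eq_zero.1 ?_).resolve_right h
      simp only [planeDet]
      linear_combination (A (1, 0)).1 * h2 - (A (1, 0)).2 * h1

/-- Projection along the third axis is injective on the plane orthogonal to `m` once `m 2 ≠ 0`, and
the minor is the determinant of `A` followed by that projection. -/
theorem planeMinor_ne_zero {A : ℝ × ℝ →L[ℝ] E3} (hA : Function.Injective A) {m : E3}
    (hm : m 2 ≠ 0) (hAm : ∀ v, inner ℝ (A v) m = 0) : planeMinor A ≠ 0 := by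
  have h2 : ∀ v, (A v) 0 = 0 → (A v) 1 = 0 → v = 0 := by
    intro v h0 h1
    refine (injective_iff_map_eq_zero A).1 hA v ?_
    have := hAm v
    simp [PiLp.inner_apply, Fin.sum_univ_three, h0, h1, hm] at this
    ext i
    fin_cases i <;> simp [h0, h1, this]
  let P : E3 →L[ℝ] ℝ × ℝ := (EuclideanSpace.proj (0 : Fin 3) : E3 →L[ℝ] ℝ).prod
    (EuclideanSpace.proj (1 : Fin 3))
  have : Function.Injective (P.comp A) := (injective_iff_map_eq_zero _).2 fun v hv =>
    h2 v (congrArg Prod.fst hv) (congrArg Prod.snd hv)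
  exact injective_iff_planeDet_ne_zero.1 this

theorem IsPreconnected.forall_pos_or_forall_neg {α : Type*} [TopologicalSpace α] {s : Set α}
    (hs : IsPreconnected s) {g : α → ℝ} (hg : ContinuousOn g s) (h0 : ∀ a ∈ s, g a ≠ 0) :
    (∀ a ∈ s, 0 < g a) ∨ (∀ a ∈ s, g a < 0) := by
  by_contra! h
  obtain ⟨⟨a, ha, hga⟩, b, hb, hgb⟩ := h
  obtain ⟨c, hc, hgc⟩ := hs.intermediate_value ha hb hg ⟨hga, hgb⟩
  exact h0 c hc hgc

/-- On the connected set `O ×ˢ Ioo 0 ε` the function keeps one strict sign; the limit `l → 0⁺`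
preserves it weakly. -/
theorem forall_nonneg_or_forall_nonpos_of_ne_zero {O : Set (ℝ × ℝ)} (hO : IsPreconnected O)
    {G : ℝ × ℝ → ℝ → ℝ} {ε : ℝ} (hε : 0 < ε)
    (hG : ContinuousOn (fun s : (ℝ × ℝ) × ℝ => G s.1 s.2) (O ×ˢ univ))
    (h0 : ∀ q ∈ O, ∀ l ∈ Ioo 0 ε, G q l ≠ 0) :
    (∀ q ∈ O, 0 ≤ G q 0) ∨ (∀ q ∈ O, G q 0 ≤ 0) := by
  have hlim : ∀ q ∈ O, Filter.Tendsto (G q) (𝓝[>] 0) (𝓝 (G q 0)) := by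
    intro q hq
    have : ContinuousOn (G q) univ :=
      hG.comp (f := fun l : ℝ => (q, l)) (by fun_prop) fun l _ => ⟨hq, mem_univ l⟩
    exact (continuousOn_univ.1 this).continuousAt.tendsto.mono_left nhdsWithin_le_nhds
  have hmem : Ioo 0 ε ∈ 𝓝[>] (0 : ℝ) := Ioo_mem_nhdsGT hε
  rcases IsPreconnected.forall_pos_or_forall_neg (hO.prod isPreconnected_Ioo)
    (hG.mono (prod_mono_right (subset_univ (Ioo 0 ε)))) (fun s hs => h0 _ hs.1 _ hs.2) with h | h
  · exact Or.inl fun q hq => ge_of_tendsto (hlim q hq)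
      (Filter.eventually_of_mem hmem fun l hl => (h (q, l) ⟨hq, hl⟩).le)
  · exact Or.inr fun q hq => le_of_tendsto (hlim q hq)
      (Filter.eventually_of_mem hmem fun l hl => (h (q, l) ⟨hq, hl⟩).le)

/-! ### The slope chart of a front -/

theorem inner_fderiv_unitNormal {x n : ℝ × ℝ → E3} {V : Set (ℝ × ℝ)} (hV : IsOpen V)
    (hn : IsUnitNormalOn x n V) {p : ℝ × ℝ} (hp : p ∈ V) (v : ℝ × ℝ) :
    inner ℝ (fderiv ℝ n p v) (n p) = 0 := by
  have hd := ((hn.1.contDiffAt (hV.mem_nhds hp)).differentiableAt (by simp)).hasFDerivAt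
  have h1 := (hd.inner ℝ hd).congr_of_eventuallyEq (f₁ := fun _ => (1 : ℝ)) (by
    filter_upwards [hV.mem_nhds hp] with q hq
    rw [real_inner_self_eq_norm_sq, (hn.2 q hq).1, one_pow])
  have h2 := congrArg (fun f : ℝ × ℝ →L[ℝ] ℝ => f v) (h1.unique (hasFDerivAt_const _ _))
  simpa [real_inner_comm] using h2

/-- The first coordinate of `X` together with the slope of the tangent plane with normal `N` in
the direction of the second axis. -/
noncomputable def slopeChart (X N : ℝ × ℝ → E3) (q : ℝ × ℝ) : ℝ × ℝ :=
  (X q 0, -(N q 1) / N q 2)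

section Chart

variable {X N : ℝ × ℝ → E3} {V : Set (ℝ × ℝ)}

theorem contDiffOn_slopeChart (hX : ContDiffOn ℝ ∞ X V) (hN : ContDiffOn ℝ ∞ N V)
    (hN2 : ∀ q ∈ V, N q 2 ≠ 0) : ContDiffOn ℝ ∞ (slopeChart X N) V :=
  (contDiffOn_euclidean.1 hX 0).prodMk
    ((contDiffOn_euclidean.1 hN 1).neg.div (contDiffOn_euclidean.1 hN 2) hN2)

theorem fderiv_slopeChart {p : ℝ × ℝ} (hX : DifferentiableAt ℝ X p) (hN : DifferentiableAt ℝ N p)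
    (hNp : N p = EuclideanSpace.single 2 1) (v : ℝ × ℝ) :
    fderiv ℝ (slopeChart X N) p v = ((fderiv ℝ X p v) 0, -(fderiv ℝ N p v) 1) := by
  have h1 : N p 1 = 0 := by simp [hNp]
  have h2 : N p 2 = 1 := by simp [hNp]
  have hd := (hasFDerivAt_coord hN 1).neg.mul
    ((hasDerivAt_inv (by simp [h2])).comp_hasFDerivAt p (hasFDerivAt_coord hN 2))
  have := (hasFDerivAt_coord hX 0).prodMk hd
  have e : HasFDerivAt (slopeChart X N) _ p := this
  rw [e.fderiv]
  simp [h1, h2]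

/-- At a point where the tangent map of a front has rank one, the slope chart is a local
diffeomorphism. -/
theorem injective_fderiv_slopeChart (hV : IsOpen V) (hX : ContDiffOn ℝ ∞ X V)
    (hN : IsUnitNormalOn X N V) {p : ℝ × ℝ} (hp : p ∈ V)
    (himm : Function.Injective (fderiv ℝ (fun s => (X s, N s)) p))
    (hrange : ∀ v, (fderiv ℝ X p v) 1 = 0 ∧ (fderiv ℝ X p v) 2 = 0)
    {u : ℝ × ℝ} (hu : (fderiv ℝ X p u) 0 ≠ 0) (hNp : N p = EuclideanSpace.single 2 1) :
    Function.Injective (fderiv ℝ (slopeChart X N) p) := by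
  have hdX := (hX.contDiffAt (hV.mem_nhds hp)).differentiableAt (by simp)
  have hdN := (hN.1.contDiffAt (hV.mem_nhds hp)).differentiableAt (by simp)
  rw [injective_iff_map_eq_zero]
  intro k hk
  rw [fderiv_slopeChart hdX hdN hNp, Prod.mk_eq_zero, neg_eq_zero] at hk
  have hXk : fderiv ℝ X p k = 0 := by
    ext i
    fin_cases i
    · exact hk.1
    · exact (hrange k).1
    · exact (hrange k).2
  -- By symmetry `⟨DX u, DN k⟩ = ⟨DX k, DN u⟩ = 0`, and `DX u` is a nonzero multiple of the first
  -- axis.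
  have hN0 : (fderiv ℝ N p k) 0 = 0 := by
    have := inner_fderiv_normal_symm hV hX hN hp u k
    simp only [hXk, inner_zero_left] at this
    simpa [PiLp.inner_apply, Fin.sum_univ_three, hrange u, hu] using this
  have hN2 : (fderiv ℝ N p k) 2 = 0 := by
    have := inner_fderiv_unitNormal hV hN hp k
    simpa [hNp, EuclideanSpace.inner_single_right] using this
  have hNk : fderiv ℝ N p k = 0 := by
    ext i
    fin_cases i
    · exact hN0
    · exact hk.2
    · exact hN2
  refine (injective_iff_map_eq_zero _).1 himm k ?_
  rw [(hdX.hasFDerivAt.prodMk hdN.hasFDerivAt).fderiv]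
  simp [hXk, hNk]

end Chart

/-! ### Parallel maps and the sign of the planar minor -/

theorem continuousOn_planeMinor_parallel {X M : ℝ × ℝ → E3} {V : Set (ℝ × ℝ)} (hV : IsOpen V)
    (hX : ContDiffOn ℝ ∞ X V) (hM : ContDiffOn ℝ ∞ M V) :
    ContinuousOn (fun s : (ℝ × ℝ) × ℝ => planeMinor (fderiv ℝ X s.1 + s.2 • fderiv ℝ M s.1))
      (V ×ˢ univ) := by
  have h : ∀ {Y : ℝ × ℝ → E3}, ContDiffOn ℝ ∞ Y V → ∀ v i,
      ContinuousOn (fun s : (ℝ × ℝ) × ℝ => (fderiv ℝ Y s.1 v) i) (V ×ˢ univ) := fun hY v i =>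
    (contDiffOn_fderiv_apply hV hY v i).continuousOn.comp continuousOn_fst fun s hs => hs.1
  have h' : ∀ v i, ContinuousOn
      (fun s : (ℝ × ℝ) × ℝ => ((fderiv ℝ X s.1 + s.2 • fderiv ℝ M s.1) v) i) (V ×ˢ univ) :=
    fun v i => (h hX v i).add (continuousOn_snd.mul (h hM v i))
  exact ((h' _ _).mul (h' _ _)).sub ((h' _ _).mul (h' _ _))

/-- Along a unit normal field transverse to the horizontal plane, immersive parallel maps on one
side force the planar minor of the differential to have a weak sign. -/
theorem planeMinor_nonneg_or_nonpos {X M : ℝ × ℝ → E3} {V : Set (ℝ × ℝ)} {ε : ℝ} (hV : IsOpen V)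
    (hVc : IsPreconnected V) (hX : ContDiffOn ℝ ∞ X V) (hM : IsUnitNormalOn X M V)
    (hM2 : ∀ q ∈ V, M q 2 ≠ 0) (hε : 0 < ε)
    (hpar : ∀ q ∈ V, ∀ l ∈ Ioo 0 ε, Function.Injective (fderiv ℝ (fun s => X s + l • M s) q)) :
    (∀ q ∈ V, 0 ≤ planeMinor (fderiv ℝ X q)) ∨ (∀ q ∈ V, planeMinor (fderiv ℝ X q) ≤ 0) := by
  have key := forall_nonneg_or_forall_nonpos_of_ne_zero hVc hε
    (G := fun q l => planeMinor (fderiv ℝ X q + l • fderiv ℝ M q))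
    (continuousOn_planeMinor_parallel hV hX hM.1) (by
      intro q hq l hl
      have hdX := (hX.contDiffAt (hV.mem_nhds hq)).differentiableAt (by simp)
      have hdM := (hM.1.contDiffAt (hV.mem_nhds hq)).differentiableAt (by simp)
      have hi := hpar q hq l hl
      have e : HasFDerivAt (fun s => X s + l • M s) (fderiv ℝ X q + l • fderiv ℝ M q) q :=
        hdX.hasFDerivAt.add (hdM.hasFDerivAt.const_smul l)
      rw [e.fderiv] at hi
      -- `M` is also normal to the parallel maps, because both `DX v` and `DM v` are orthogonal to
      -- it.
      refine planeMinor_ne_zero hi (hM2 q hq) fun v => ?_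
      simp [inner_add_left, inner_smul_left, (hM.2 q hq).2 v,
        inner_fderiv_unitNormal hV hM hq v])
  have e : ∀ q, fderiv ℝ X q + (0 : ℝ) • fderiv ℝ M q = fderiv ℝ X q := fun q =>
    ContinuousLinearMap.ext fun v => by simp
  simpa only [e] using key

/-! ### The normal form in adapted position -/

/-- The rank-one normal form near a point at which the tangent plane is horizontal and the image of
the differential is the first axis. -/
theorem exists_rankOneForm_of_adapted {X N M : ℝ × ℝ → E3} {V : Set (ℝ × ℝ)} {ε : ℝ}
    (hV : IsOpen V) (h0 : 0 ∈ V) (hX : ContDiffOn ℝ ∞ X V) (hX0 : X 0 = 0)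
    (hN : IsUnitNormalOn X N V) (hN0 : N 0 = EuclideanSpace.single 2 1)
    (himm : Function.Injective (fderiv ℝ (fun s => (X s, N s)) 0))
    (hrange : ∀ v, (fderiv ℝ X 0 v) 1 = 0 ∧ (fderiv ℝ X 0 v) 2 = 0)
    {u : ℝ × ℝ} (hu : (fderiv ℝ X 0 u) 0 ≠ 0)
    (hM : IsUnitNormalOn X M V) (hM0 : M 0 2 ≠ 0) (hε : 0 < ε)
    (hpar : ∀ q ∈ V, ∀ l ∈ Ioo 0 ε, Function.Injective (fderiv ℝ (fun s => X s + l • M s) q)) :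
    ∃ (r : ℝ) (lam : ℝ × ℝ → ℝ) (f₁ f₂ : ℝ → ℝ), 0 < r ∧
      ContDiffOn ℝ ∞ lam (Ioo (-r) r ×ˢ Ioo (-r) r) ∧
      ContDiffOn ℝ ∞ f₁ (Ioo (-r) r) ∧ ContDiffOn ℝ ∞ f₂ (Ioo (-r) r) ∧
      lam 0 = 0 ∧
      ((∀ q ∈ Ioo (-r) r ×ˢ Ioo (-r) r, 0 ≤ lam q) ∨
        (∀ q ∈ Ioo (-r) r ×ˢ Ioo (-r) r, lam q ≤ 0)) ∧
      IsTangentMovingBasis (rankOneForm lam f₁ f₂) (rankOneBasis (rankOneForm lam f₁ f₂))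
        (Ioo (-r) r ×ˢ Ioo (-r) r) ∧
      (∀ q ∈ Ioo (-r) r ×ˢ Ioo (-r) r,
        LambdaMat (rankOneForm lam f₁ f₂) (rankOneBasis (rankOneForm lam f₁ f₂)) q =
          !![1, 0; 0, lam q]) ∧
      REquivalent X V (rankOneForm lam f₁ f₂) (Ioo (-r) r ×ˢ Ioo (-r) r) := by
  set Φ := slopeChart X N with hΦdef
  have coordCont : ∀ {Z : ℝ × ℝ → E3}, ContDiffOn ℝ ∞ Z V → ∀ i,
      ContinuousOn (fun q => Z q i) V := fun hZ i => (contDiffOn_euclidean.1 hZ i).continuousOn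
  -- a ball on which both normals are transverse and the chart is a local diffeomorphism
  let V' := V ∩ (fun q => N q 2) ⁻¹' {0}ᶜ
  have hV' : IsOpen V' := (coordCont hN.1 2).isOpen_inter_preimage hV isOpen_compl_singleton
  have hΦV' : ContDiffOn ℝ ∞ Φ V' := contDiffOn_slopeChart (hX.mono inter_subset_left)
    (hN.1.mono inter_subset_left) fun q hq => hq.2
  have hJ : ContinuousOn (fun q => planeDet (fderiv ℝ Φ q)) V' := by
    have hd := hΦV'.continuousOn_fderiv_of_isOpen hV' (by simp)
    have hd' : ∀ v, ContinuousOn (fun q => fderiv ℝ Φ q v) V' := fun v =>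
      hd.clm_apply continuousOn_const
    exact ((hd' _).fst.mul (hd' _).snd).sub ((hd' _).fst.mul (hd' _).snd)
  let V'' := V' ∩ (fun q => planeDet (fderiv ℝ Φ q)) ⁻¹' {0}ᶜ
  have hV'' : IsOpen V'' := hJ.isOpen_inter_preimage hV' isOpen_compl_singleton
  have hmem : (0 : ℝ × ℝ) ∈ V'' ∩ (V ∩ (fun q => M q 2) ⁻¹' {0}ᶜ) :=
    ⟨⟨⟨h0, by simp [hN0]⟩, injective_iff_planeDet_ne_zero.1
      (injective_fderiv_slopeChart hV hX hN h0 himm hrange hu hN0)⟩, h0, hM0⟩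
  obtain ⟨δ, hδ, hball⟩ := Metric.isOpen_iff.1
    (hV''.inter ((coordCont hM.1 2).isOpen_inter_preimage hV isOpen_compl_singleton)) 0 hmem
  -- A ball is connected, so both the chart determinant and the parallel minors have constant sign
  -- on it.
  set O := Metric.ball (0 : ℝ × ℝ) δ
  have hO : IsOpen O := Metric.isOpen_ball
  have hOc : IsPreconnected O := (convex_ball _ _).isPreconnected
  have hOV : O ⊆ V := fun q hq => (hball hq).1.1.1
  have hOV' : O ⊆ V' := fun q hq => (hball hq).1.1
  have hminor := planeMinor_nonneg_or_nonpos hO hOc (hX.mono hOV)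
    ⟨hM.1.mono hOV, fun q hq => hM.2 q (hOV hq)⟩ (fun q hq => (hball hq).2.2) hε
    fun q hq => hpar q (hOV hq)
  have hdet := IsPreconnected.forall_pos_or_forall_neg hOc (hJ.mono hOV')
    fun q hq => (hball hq).1.2
  have hΦ0 : Φ 0 = 0 := by simp [hΦdef, slopeChart, hX0, hN0]
  obtain ⟨r, h, hr, hsrc, hh0, htgt, hsm, hsm', hinv⟩ := exists_localInverse_on_square hO
    (Metric.mem_ball_self hδ) (hΦV'.mono hOV') hΦ0
    fun q hq => injective_iff_planeDet_ne_zero.2 (hball hq).1.2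
  have hSO := isOpen_square r
  rw [hsrc] at hsm
  have hmap : ∀ q ∈ Ioo (-r) r ×ˢ Ioo (-r) r, h q ∈ h.target := fun q hq =>
    h.map_source (hsrc ▸ hq)
  have hΦh : ∀ q ∈ Ioo (-r) r ×ˢ Ioo (-r) r, Φ (h q) = q := fun q hq => by
    rw [← hinv _ (hmap q hq), h.left_inv (hsrc ▸ hq)]
  have hdh : ∀ q ∈ Ioo (-r) r ×ˢ Ioo (-r) r, DifferentiableAt ℝ h q := fun q hq =>
    (hsm.contDiffAt (hSO.mem_nhds hq)).differentiableAt (by simp)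
  have hdX : ∀ p ∈ V, DifferentiableAt ℝ X p := fun p hp =>
    (hX.contDiffAt (hV.mem_nhds hp)).differentiableAt (by simp)
  set Y : ℝ × ℝ → E3 := X ∘ h with hYdef
  have hY : ContDiffOn ℝ ∞ Y (Ioo (-r) r ×ˢ Ioo (-r) r) :=
    hX.comp hsm fun q hq => hOV (htgt (hmap q hq))
  have hdY : ∀ q ∈ Ioo (-r) r ×ˢ Ioo (-r) r, DifferentiableAt ℝ Y q := fun q hq =>
    (hY.contDiffAt (hSO.mem_nhds hq)).differentiableAt (by simp)
  have hDY : ∀ q ∈ Ioo (-r) r ×ˢ Ioo (-r) r, ∀ v,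
      fderiv ℝ Y q v = fderiv ℝ X (h q) (fderiv ℝ h q v) := fun q hq v => by
    rw [hYdef, fderiv_comp q (hdX _ (hOV (htgt (hmap q hq)))) (hdh q hq)]
    rfl
  have hY1 : ∀ q ∈ Ioo (-r) r ×ˢ Ioo (-r) r, Y q 0 = q.1 := fun q hq =>
    congrArg Prod.fst (hΦh q hq)
  have hY0 : ∀ q ∈ Ioo (-r) r ×ˢ Ioo (-r) r, ∀ v, (fderiv ℝ Y q v) 0 = v.1 := fun q hq v =>
    fderiv_apply_zero_of_eventuallyEq_fst (hdY q hq)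
      (Filter.eventually_of_mem (hSO.mem_nhds hq) hY1) v
  -- The vertical derivative has first component 0, so orthogonality to `N` fixes the ratio of the
  -- other two as `-N₁/N₂`, which is the coordinate `z`.
  have hY2 : ∀ q ∈ Ioo (-r) r ×ˢ Ioo (-r) r,
      (fderiv ℝ Y q (0, 1)) 2 = q.2 * (fderiv ℝ Y q (0, 1)) 1 := fun q hq => by
    have ho := hmap q hq
    have hn2 : N (h q) 2 ≠ 0 := (hOV' (htgt ho)).2
    have horth := (hN.2 _ (hOV (htgt ho))).2 (fderiv ℝ h q (0, 1))
    rw [← hDY q hq] at horth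
    have hq2 : -(N (h q) 1) / N (h q) 2 = q.2 := congrArg Prod.snd (hΦh q hq)
    simp only [PiLp.inner_apply, Fin.sum_univ_three, hY0 q hq, RCLike.inner_apply, conj_trivial,
      mul_zero, zero_add] at horth
    rw [← hq2]
    field_simp
    linarith
  have h0S : (0 : ℝ × ℝ) ∈ Ioo (-r) r ×ˢ Ioo (-r) r := ⟨by simp [hr], by simp [hr]⟩
  have hline : ContDiffOn ℝ ∞ (fun w => Y (w, 0)) (Ioo (-r) r) :=
    hY.comp (f := fun w : ℝ => (w, (0 : ℝ))) (by fun_prop) fun w hw => ⟨hw, by simp [hr]⟩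
  have hform := rankOneForm_eqOn hr hY hY1 hY2
  obtain ⟨hbasis, hLam⟩ := rankOneForm_spec hY hY1 hY2 (fun _ => rfl) hform
  -- Near `h q` one has `X = Y ∘ Φ`, and the first two rows of `DY` are lower triangular with
  -- diagonal `(1, λ)`.
  have hsign : ∀ q ∈ Ioo (-r) r ×ˢ Ioo (-r) r,
      planeMinor (fderiv ℝ X (h q)) = (fderiv ℝ Y q (0, 1)) 1 * planeDet (fderiv ℝ Φ (h q)) := by
    intro q hq
    have ho := hmap q hq
    have hdΦ : DifferentiableAt ℝ Φ (h q) :=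
      (hΦV'.contDiffAt (hV'.mem_nhds (hOV' (htgt ho)))).differentiableAt (by simp)
    have hXe : X =ᶠ[𝓝 (h q)] Y ∘ Φ := by
      filter_upwards [h.open_target.mem_nhds ho] with p hp
      simp only [hYdef, Function.comp_apply, ← hinv p hp, h.right_inv hp]
    have hDX : ∀ v, fderiv ℝ X (h q) v = fderiv ℝ Y q (fderiv ℝ Φ (h q) v) := fun v => by
      rw [hXe.fderiv_eq, fderiv_comp _ (by rw [hΦh q hq]; exact hdY q hq) hdΦ, hΦh q hq]
      rfl
    have h1 : ∀ v, (fderiv ℝ Y q v) 1 =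
        v.1 * (fderiv ℝ Y q (1, 0)) 1 + v.2 * (fderiv ℝ Y q (0, 1)) 1 := fun v => by
      rw [map_eq_smul_add_smul]
      simp
    simp only [planeMinor, planeDet, hDX, hY0 q hq]
    rw [h1 (fderiv ℝ Φ (h q) (1, 0)), h1 (fderiv ℝ Φ (h q) (0, 1))]
    ring
  refine ⟨r, fun q => (fderiv ℝ Y q (0, 1)) 1, fun w => Y (w, 0) 1, fun w => Y (w, 0) 2, hr,
    contDiffOn_fderiv_apply hSO hY _ _, contDiffOn_euclidean.1 hline 1,
    contDiffOn_euclidean.1 hline 2, ?_, ?_, hbasis, hLam,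
    h, hsrc ▸ h0S, hh0, hsrc.subset, htgt.trans hOV, hsrc.symm ▸ hsm, hsm', ?_⟩
  -- `λ` vanishes at the origin because the image of `DX` there is the first axis.
  · simp only [hDY 0 h0S, hh0]
    exact (hrange _).1
  · rcases hminor with hm | hm <;> rcases hdet with hd | hd
    · refine Or.inl fun q hq => nonneg_of_mul_nonneg_left ?_ (hd _ (htgt (hmap q hq)))
      rw [← hsign q hq]
      exact hm _ (htgt (hmap q hq))
    · refine Or.inr fun q hq => nonpos_of_mul_nonneg_left ?_ (hd _ (htgt (hmap q hq)))
      rw [← hsign q hq]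
      exact hm _ (htgt (hmap q hq))
    · refine Or.inr fun q hq => nonpos_of_mul_nonpos_left ?_ (hd _ (htgt (hmap q hq)))
      rw [← hsign q hq]
      exact hm _ (htgt (hmap q hq))
    · refine Or.inl fun q hq => nonneg_of_mul_nonpos_left ?_ (hd _ (htgt (hmap q hq)))
      rw [← hsign q hq]
      exact hm _ (htgt (hmap q hq))
  · exact fun q hq => hform (hsrc ▸ hq)

/-! ### Reduction to adapted position -/

theorem injective_of_rankD_eq_two {f : ℝ × ℝ → E3} {q : ℝ × ℝ} (h : rankD f q = 2) :
    Function.Injective (fderiv ℝ f q) := by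
  have := (fderiv ℝ f q : ℝ × ℝ →ₗ[ℝ] E3).finrank_range_add_finrank_ker
  rw [rankD] at h
  rw [h, Module.finrank_prod, Module.finrank_self] at this
  exact LinearMap.ker_eq_bot.1 (Submodule.finrank_eq_zero.1 (by omega))

theorem IsUnitNormalOn.neg {x n : ℝ × ℝ → E3} {V : Set (ℝ × ℝ)} (h : IsUnitNormalOn x n V) :
    IsUnitNormalOn x (fun q => -n q) V :=
  ⟨h.1.neg, fun q hq => ⟨by rw [norm_neg, (h.2 q hq).1], fun v => by
    rw [inner_neg_right, (h.2 q hq).2 v, neg_zero]⟩⟩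

theorem IsUnitNormalOn.mono {x n : ℝ × ℝ → E3} {V W : Set (ℝ × ℝ)} (h : IsUnitNormalOn x n V)
    (hWV : W ⊆ V) : IsUnitNormalOn x n W :=
  ⟨h.1.mono hWV, fun q hq => h.2 q (hWV hq)⟩

theorem IsUnitNormalOn.comp_isometry {x n : ℝ × ℝ → E3} {V : Set (ℝ × ℝ)}
    (h : IsUnitNormalOn x n V) (φ : E3 ≃ₗᵢ[ℝ] E3) :
    IsUnitNormalOn (fun q => φ (x q)) (fun q => φ (n q)) V := by
  refine ⟨φ.contDiff.comp_contDiffOn h.1, fun q hq => ⟨by rw [φ.norm_map, (h.2 q hq).1],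
    fun v => ?_⟩⟩
  have : fderiv ℝ (fun q => φ (x q)) q v = φ (fderiv ℝ x q v) :=
    congrArg (fun A : ℝ × ℝ →L[ℝ] E3 => A v) φ.toContinuousLinearEquiv.comp_fderiv
  rw [this, φ.inner_map_map, (h.2 q hq).2 v]

/-- Replacing `n` by `-n` exchanges positive and negative `l`, so only one side has to be treated.
-/
theorem IsParallellySmoothableAt.exists_pos {x : ℝ × ℝ → E3} {U : Set (ℝ × ℝ)} {p : ℝ × ℝ}
    (h : IsParallellySmoothableAt x U p) :
    ∃ (V : Set (ℝ × ℝ)) (m : ℝ × ℝ → E3) (ε : ℝ), IsOpen V ∧ p ∈ V ∧ V ⊆ U ∧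
      IsUnitNormalOn x m V ∧ 0 < ε ∧
      ∀ q ∈ V, ∀ l ∈ Ioo 0 ε, Function.Injective (fderiv ℝ (fun s => x s + l • m s) q) := by
  obtain ⟨-, V, n, ε, hV, hp, hVU, hn, hε, h | h⟩ := h
  · exact ⟨V, n, ε, hV, hp, hVU, hn, hε, fun q hq l hl => injective_of_rankD_eq_two (h q hq l hl)⟩
  · refine ⟨V, fun q => -n q, ε, hV, hp, hVU, hn.neg, hε, fun q hq l hl => ?_⟩
    have := injective_of_rankD_eq_two (h q hq (-l) ⟨neg_lt_neg hl.2, neg_lt_zero.2 hl.1⟩)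
    simpa only [smul_neg, neg_smul] using this

end Wavefront

theorem mainTheorem12 (x : ℝ × ℝ → Wavefront.E3) (U : Set (ℝ × ℝ))
    (h0 : (0 : ℝ × ℝ) ∈ U) (hx0 : x 0 = 0)
    (hfront : Wavefront.IsWavefrontOn x U) (hproper : Wavefront.IsProperOn x U)
    (hrank : Wavefront.rankD x 0 = 1)
    (hsmooth : Wavefront.IsParallellySmoothableAt x U 0) :
    ∃ (r : ℝ) (lam : ℝ × ℝ → ℝ) (f₁ f₂ : ℝ → ℝ) (φ : Wavefront.E3 ≃ₗᵢ[ℝ] Wavefront.E3),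
      0 < r ∧
      ContDiffOn ℝ ∞ lam (Ioo (-r) r ×ˢ Ioo (-r) r) ∧
      ContDiffOn ℝ ∞ f₁ (Ioo (-r) r) ∧ ContDiffOn ℝ ∞ f₂ (Ioo (-r) r) ∧
      lam 0 = 0 ∧
      ((∀ q ∈ Ioo (-r) r ×ˢ Ioo (-r) r, 0 ≤ lam q) ∨
        (∀ q ∈ Ioo (-r) r ×ˢ Ioo (-r) r, lam q ≤ 0)) ∧
      Wavefront.IsTangentMovingBasis (Wavefront.rankOneForm lam f₁ f₂)
        (Wavefront.rankOneBasis (Wavefront.rankOneForm lam f₁ f₂))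
        (Ioo (-r) r ×ˢ Ioo (-r) r) ∧
      (∀ q ∈ Ioo (-r) r ×ˢ Ioo (-r) r,
        Wavefront.LambdaMat (Wavefront.rankOneForm lam f₁ f₂)
          (Wavefront.rankOneBasis (Wavefront.rankOneForm lam f₁ f₂)) q = !![1, 0; 0, lam q]) ∧
      Wavefront.REquivalent (fun q => φ (x q)) U (Wavefront.rankOneForm lam f₁ f₂)
        (Ioo (-r) r ×ˢ Ioo (-r) r) := by
  open Wavefront in
  obtain ⟨hU, hx, hfr⟩ := hfront
  obtain ⟨V, n, hV, h0V, hVU, hn, himm⟩ := hfr 0 h0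
  obtain ⟨W, m, ε, hW, h0W, hWU, hm, hε, hpar⟩ := hsmooth.exists_pos
  -- The front condition and parallel smoothability come with unrelated normals `n` and `m`; they
  -- agree up to sign at the origin.
  have hnm := inner_unitNormal_sq_eq_one hproper hV hW hVU h0V h0W hn hm
  -- a unit vector spanning the image of the differential
  obtain ⟨⟨_, u, rfl⟩, hu0, hspan⟩ := finrank_eq_one_iff'.1 hrank
  have hu0' : fderiv ℝ x 0 u ≠ 0 := fun h => hu0 (Subtype.ext h)
  have hspan' : ∀ v, ∃ c : ℝ, c • fderiv ℝ x 0 u = fderiv ℝ x 0 v := fun v => by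
    obtain ⟨c, hc⟩ := hspan ⟨_, v, rfl⟩
    exact ⟨c, congrArg Subtype.val hc⟩
  set a := ‖fderiv ℝ x 0 u‖
  have ha : a ≠ 0 := norm_ne_zero_iff.2 hu0'
  obtain ⟨φ, hφt, hφn⟩ := exists_isometry_of_orthogonal (t := a⁻¹ • fderiv ℝ x 0 u) (n := n 0)
    (by rw [norm_smul, norm_inv, Real.norm_eq_abs, abs_norm]; exact inv_mul_cancel₀ ha)
    (hn.2 0 h0V).1 (by rw [inner_smul_left, (hn.2 0 h0V).2 u, mul_zero])
  have hφu : φ (fderiv ℝ x 0 u) = a • EuclideanSpace.single 0 1 := by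
    rw [← hφt, map_smul, smul_inv_smul₀ ha]
  have hD : ∀ (f : ℝ × ℝ → E3) q v, fderiv ℝ (fun s => φ (f s)) q v = φ (fderiv ℝ f q v) :=
    fun f q v => congrArg (fun A : ℝ × ℝ →L[ℝ] E3 => A v) φ.toContinuousLinearEquiv.comp_fderiv
  have hd : ∀ {f : ℝ × ℝ → E3} {S : Set (ℝ × ℝ)}, IsOpen S → 0 ∈ S → ContDiffOn ℝ ∞ f S →
      HasFDerivAt f (fderiv ℝ f 0) 0 := fun hS h0S hf =>
    ((hf.contDiffAt (hS.mem_nhds h0S)).differentiableAt (by simp)).hasFDerivAt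
  obtain ⟨r, lam, f₁, f₂, hr, h1, h2, h3, h4, h5, h6, h7, h, h8, h9, h10, h11, h12⟩ :=
    exists_rankOneForm_of_adapted (X := fun q => φ (x q)) (N := fun q => φ (n q))
      (M := fun q => φ (m q)) (V := V ∩ W) (u := u) (hV.inter hW) ⟨h0V, h0W⟩
      (φ.contDiff.comp_contDiffOn (hx.mono (inter_subset_left.trans hVU))) (by simp [hx0])
      ((hn.mono inter_subset_left).comp_isometry φ) hφn
      (by
        have hinj := himm 0 h0V
        rw [((hd hU h0 hx).prodMk (hd hV h0V hn.1)).fderiv] at hinj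
        have e := (hd hU h0 (φ.contDiff.comp_contDiffOn hx)).prodMk
          (hd hV h0V (φ.contDiff.comp_contDiffOn hn.1))
        rw [injective_iff_map_eq_zero] at hinj ⊢
        intro v hv
        erw [e.fderiv] at hv
        have hv1 := congrArg Prod.fst hv
        have hv2 := congrArg Prod.snd hv
        refine hinj v (Prod.ext (φ.injective ?_) (φ.injective ?_))
        · rw [Prod.fst_zero, map_zero]; exact (hD x 0 v).symm.trans hv1
        · rw [Prod.snd_zero, map_zero]; exact (hD n 0 v).symm.trans hv2)
      (fun v => by
        obtain ⟨c, hc⟩ := hspan' v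
        rw [hD, ← hc, map_smul, hφu]
        simp)
      (by rw [hD, hφu]; simpa using ha)
      ((hm.mono inter_subset_right).comp_isometry φ)
      -- The third component of `φ (m 0)` is `⟨n 0, m 0⟩`, whose square is 1.
      (fun hm2 => by
        rw [← φ.inner_map_map, hφn, EuclideanSpace.inner_single_left, hm2] at hnm
        simp at hnm)
      hε
      (fun q hq l hl => by
        have e : (fun s => φ (x s) + l • φ (m s)) = fun s => φ (x s + l • m s) := by
          funext s
          rw [map_add, map_smul]
        rw [e]
        intro v w hvw
        rw [hD, hD] at hvw
        exact hpar q hq.2 l hl (φ.injective hvw))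
  exact ⟨r, lam, f₁, f₂, φ, hr, h1, h2, h3, h4, h5, h6, h7, h, h8, h9, h10,
    h11.trans (inter_subset_left.trans hVU), h12⟩
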